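/- Let $K$ be an algebraically closed field of characteristic zero, let $N,M\ge 0$, and let $\omega\in\mathbb{R}^N$ have rationally independent coordinates (linearly independent over $\mathbb{Q}$). Let $S_\omega$ be the field of $\omega$-positive Puiseux series: formal series $\varphi=\sum_{\alpha\in\mathbb{Q}^N}c_\alpha x^\alpha$ with $c_\alpha\in K$, whose set of exponents $\mathcal{E}(\varphi)=\{\alpha\mid c_\alpha\ne 0\}$ satisfies $\mathcal{E}(\varphi)\subset\frac1k\mathbb{Z}^N$ for some integer $k\ge1$ and $\gamma+\mathcal{E}(\varphi)\subset\sigma$ for some $\gamma\in\mathbb{Q}^N$ and some convex rational polyhedral cone $\sigma\subset\mathbb{R}^N$ (that is, $\sigma=\{\sum_i\lambda_iv_i\mid\lambda_i\ge0\}$ for finitely many $v_i\in\mathbb{Q}^N$) with $\omega\cdot v\ge0$ for all $v\in\sigma$. Write $K[x^{\pm1},y]=K[x_1^{\pm1},\dots,x_N^{\pm1}][y_1,\dots,y_M]$ and let $I\subset K[x^{\pm1},y]$ be an ideal. Let $\eta\in(\mathbb{R}\cup\{\infty\})^M$ and $\Lambda(\eta)=\{i\mid\eta_i\neq\infty\}$,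 with the conventions $\infty\cdot 0=0$ and $\infty\cdot b=\infty$ for $b>0$. For $f=\sum a_{\alpha,\beta}x^\alpha y^\beta\in K[x^{\pm1},y]$, the $(\omega,\eta)$-order of $f$ is $\nu(f)=\min_{a_{\alpha,\beta}\neq0}(\omega\cdot\alpha+\eta\cdot\beta)$ ($=\infty$ if $f=0$), and the $(\omega,\eta)$-initial part of $f$ is $$\mathrm{In}_{\omega,\eta}(f)=\sum_{\omega\cdot\alpha+\eta\cdot\beta=\nu(f)}a_{\alpha,\beta}x^\alpha y^\beta\quad\text{if }\nu(f)<\infty,\qquad \mathrm{In}_{\omega,\eta}(f)=0\quad\text{if }\nu(f)=\infty.$$ The $(\omega,\eta)$-initial ideal of $I$ is the ideal of $K[x^{\pm1},y]$ $$\mathcal{I}n_{\omega,\eta}I=\big\langle\{\mathrm{In}_{\omega,\eta}(f)\mid f\in I\}\cup\{y_i\mid i\notin\Lambda(\eta)\}\big\rangle .$$ An $\omega$-solution of an ideal $J\subset K[x^{\pm1},y]$ is a point $\varphi\in S_\omega^M$ that is a common zero of the extension of $J$ to $S_\omega[y]$ under the natural inclusion $K[x^{\pm1},y]\subset S_\omega[y]$.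 The torus of $\eta$ is $$T_\eta=\{\varphi\in S_\omega^M\mid \varphi_i\ne0\text{ for }i\in\Lambda(\eta),\ \varphi_i=0\text{ for }i\notin\Lambda(\eta)\}.$$ The tropical variety of $I$ is the set of pairs $(\omega',\eta')\in\mathbb{R}^N\times(\mathbb{R}\cup\{\infty\})^M$ such that $\mathcal{I}n_{\omega',\eta'}I\cap K[x^{\pm1},y_i\mid i\in\Lambda(\eta')]$ contains no monomial $c\,x^\alpha y^\beta$ with $c\in K\setminus\{0\}$. **Proposition.** The ideal $\mathcal{I}n_{\omega,\eta}I$ has an $\omega$-solution in $T_\eta$ if and only if $(\omega,\eta)$ lies in the tropical variety of $I$. -/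

import Mathlib

noncomputable section

namespace OmegaPuiseux

/-! ### Exponents, ordered by `ω` -/

/-- The inclusion of `ℚ^N` in `ℝ^N`. -/
def toReal {N : ℕ} (α : Fin N → ℚ) : Fin N → ℝ := fun i => (α i : ℝ)

theorem toReal_add {N : ℕ} (α β : Fin N → ℚ) : toReal (α + β) = toReal α + toReal β := by
  funext i; simp [toReal]

theorem toReal_sub {N : ℕ} (α β : Fin N → ℚ) : toReal (α - β) = toReal α - toReal β := by
  funext i; simp [toReal]

/-- The pairing `ω · α` of a real vector with a rational vector. -/
def pair {N : ℕ} (ω : Fin N → ℝ) (α : Fin N → ℚ) : ℝ := ω ⬝ᵥ toReal α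

theorem pair_add {N : ℕ} (ω : Fin N → ℝ) (α β : Fin N → ℚ) :
    pair ω (α + β) = pair ω α + pair ω β := by
  simp [pair, toReal_add, dotProduct_add]

theorem pair_sub {N : ℕ} (ω : Fin N → ℝ) (α β : Fin N → ℚ) :
    pair ω (α - β) = pair ω α - pair ω β := by
  simp [pair, toReal_sub, dotProduct_sub]

theorem pair_injective {N : ℕ} {ω : Fin N → ℝ} (hω : LinearIndependent ℚ ω) :
    Function.Injective (pair ω) := by
  intro α β h
  have h0 : pair ω (α - β) = 0 := by rw [pair_sub, h, sub_self]
  have h1 : ∑ i, (α - β) i • ω i = 0 := by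
    rw [← h0]
    simp only [pair, dotProduct, toReal, Rat.smul_def]
    exact Finset.sum_congr rfl fun i _ => mul_comm _ _
  have h2 := Fintype.linearIndependent_iff.1 hω _ h1
  funext i
  exact sub_eq_zero.1 (h2 i)

/-- The group `ℚ^N`, to be ordered by `α ≤ α' ↔ ω · α ≤ ω · α'`, for a vector `ω` with rationally
independent coordinates. -/
def Exponent {N : ℕ} (ω : Fin N → ℝ) (_hω : LinearIndependent ℚ ω) : Type := Fin N → ℚ

instance {N : ℕ} (ω : Fin N → ℝ) (hω : LinearIndependent ℚ ω) : AddCommGroup (Exponent ω hω) :=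
  inferInstanceAs (AddCommGroup (Fin N → ℚ))

/-- The identification of `ℚ^N` with `Exponent ω hω` (the identity map). -/
def toExp {N : ℕ} {ω : Fin N → ℝ} (hω : LinearIndependent ℚ ω) :
    (Fin N → ℚ) ≃+ Exponent ω hω :=
  AddEquiv.refl _

instance {N : ℕ} (ω : Fin N → ℝ) (hω : LinearIndependent ℚ ω) : LinearOrder (Exponent ω hω) :=
  LinearOrder.lift' (fun α => pair ω ((toExp hω).symm α))
    ((pair_injective hω).comp (toExp hω).symm.injective)

theorem exponent_le_iff {N : ℕ} {ω : Fin N → ℝ} {hω : LinearIndependent ℚ ω}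
    (α β : Exponent ω hω) :
    α ≤ β ↔ pair ω ((toExp hω).symm α) ≤ pair ω ((toExp hω).symm β) := Iff.rfl

instance {N : ℕ} (ω : Fin N → ℝ) (hω : LinearIndependent ℚ ω) :
    IsOrderedCancelAddMonoid (Exponent ω hω) where
  add_le_add_left a b h c := by
    rw [exponent_le_iff] at h ⊢
    rw [map_add, map_add, pair_add, pair_add]
    linarith
  le_of_add_le_add_left a b c h := by
    rw [exponent_le_iff] at h ⊢
    rw [map_add, map_add, pair_add, pair_add] at h
    linarith

/-! ### Rational cones and sets of exponents of `ω`-positive Puiseux series -/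

/-- The cone `{λ₁ v₁ + ⋯ + λ_r v_r | λ_i ≥ 0}` generated by finitely many rational vectors. -/
def ratCone {N : ℕ} (s : Finset (Fin N → ℚ)) : Set (Fin N → ℝ) :=
  {u | ∃ c : (Fin N → ℚ) → ℝ, (∀ v, 0 ≤ c v) ∧ u = ∑ v ∈ s, c v • toReal v}

/-- Convex rational polyhedral cones in `ℝ^N`. -/
def IsRationalCone {N : ℕ} (σ : Set (Fin N → ℝ)) : Prop :=
  ∃ s : Finset (Fin N → ℚ), σ = ratCone s

/-- A cone is `ω`-positive when `ω · v ≥ 0` for all its elements `v`. -/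
def IsPositiveCone {N : ℕ} (ω : Fin N → ℝ) (σ : Set (Fin N → ℝ)) : Prop :=
  ∀ v ∈ σ, 0 ≤ ω ⬝ᵥ v

/-- `E ⊆ ℚ^N` is the set of exponents of an `ω`-positive Puiseux series: it lies in
`(1/k) ℤ^N` for some integer `k ≥ 1`, and `γ + E ⊆ σ` for some `γ ∈ ℚ^N` and some
`ω`-positive convex rational polyhedral cone `σ`. -/
def IsPositiveExponentSet {N : ℕ} (ω : Fin N → ℝ) (E : Set (Fin N → ℚ)) : Prop :=
  (∃ k : ℕ, 1 ≤ k ∧ ∀ α ∈ E, ∀ i, ∃ n : ℤ, α i = (n : ℚ) / k) ∧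
  ∃ (γ : Fin N → ℚ) (σ : Set (Fin N → ℝ)), IsRationalCone σ ∧ IsPositiveCone ω σ ∧
    ∀ α ∈ E, toReal (γ + α) ∈ σ

theorem ratCone_add_mem {N : ℕ} {s : Finset (Fin N → ℚ)} {u v : Fin N → ℝ}
    (hu : u ∈ ratCone s) (hv : v ∈ ratCone s) : u + v ∈ ratCone s := by
  obtain ⟨c, hc, rfl⟩ := hu
  obtain ⟨d, hd, rfl⟩ := hv
  refine ⟨c + d, fun v => add_nonneg (hc v) (hd v), ?_⟩
  simp [add_smul, Finset.sum_add_distrib]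

theorem ratCone_mono {N : ℕ} {s t : Finset (Fin N → ℚ)} (h : s ⊆ t) : ratCone s ⊆ ratCone t := by
  classical
  rintro u ⟨c, hc, rfl⟩
  refine ⟨fun v => if v ∈ s then c v else 0, fun v => ?_, ?_⟩
  · dsimp only
    split_ifs
    exacts [hc v, le_rfl]
  · rw [← Finset.sum_subset h (fun v _ hv => by simp [hv])]
    exact Finset.sum_congr rfl fun v hv => by simp [hv]

theorem mem_ratCone {N : ℕ} {s : Finset (Fin N → ℚ)} {v : Fin N → ℚ} (h : v ∈ s) :
    toReal v ∈ ratCone s := by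
  classical
  refine ⟨fun w => if w = v then 1 else 0, fun w => ?_, ?_⟩
  · dsimp only
    split_ifs <;> norm_num
  · simp [h]

theorem isPositiveCone_ratCone {N : ℕ} {ω : Fin N → ℝ} {s : Finset (Fin N → ℚ)} :
    IsPositiveCone ω (ratCone s) ↔ ∀ v ∈ s, 0 ≤ pair ω v := by
  constructor
  · exact fun h v hv => h _ (mem_ratCone hv)
  · rintro h _ ⟨c, hc, rfl⟩
    rw [dotProduct_sum]
    refine Finset.sum_nonneg fun v hv => ?_
    rw [dotProduct_smul]
    exact mul_nonneg (hc v) (h v hv)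

theorem IsPositiveExponentSet.mono {N : ℕ} {ω : Fin N → ℝ} {E F : Set (Fin N → ℚ)}
    (hF : IsPositiveExponentSet ω F) (h : E ⊆ F) : IsPositiveExponentSet ω E := by
  obtain ⟨⟨k, hk, hl⟩, γ, σ, h1, h2, h3⟩ := hF
  exact ⟨⟨k, hk, fun α hα => hl α (h hα)⟩, γ, σ, h1, h2, fun α hα => h3 α (h hα)⟩

theorem lattice_mul {N : ℕ} {α : Fin N → ℚ} {k l : ℕ} (hl : 1 ≤ l)
    (h : ∀ i, ∃ n : ℤ, α i = (n : ℚ) / k) : ∀ i, ∃ n : ℤ, α i = (n : ℚ) / (k * l : ℕ) := by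
  intro i
  obtain ⟨n, hn⟩ := h i
  refine ⟨n * l, ?_⟩
  have : (l : ℚ) ≠ 0 := by exact_mod_cast (by omega : l ≠ 0)
  rw [hn]
  push_cast
  rw [mul_div_mul_right _ _ this]

theorem IsPositiveExponentSet.union {N : ℕ} {ω : Fin N → ℝ} {E F : Set (Fin N → ℚ)}
    (hE : IsPositiveExponentSet ω E) (hF : IsPositiveExponentSet ω F) :
    IsPositiveExponentSet ω (E ∪ F) := by
  classical
  obtain ⟨⟨k, hk, hkE⟩, γ, _, ⟨s, rfl⟩, hs, hsE⟩ := hE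
  obtain ⟨⟨l, hl, hlF⟩, δ, _, ⟨t, rfl⟩, ht, htF⟩ := hF
  refine ⟨⟨k * l, Nat.mul_pos hk hl, ?_⟩, ?_⟩
  · rintro α (hα | hα)
    · exact lattice_mul hl (hkE α hα)
    · rw [mul_comm]
      exact lattice_mul hk (hlF α hα)
  · rw [isPositiveCone_ratCone] at hs ht
    obtain ⟨ε, r, hr, h1, h2⟩ : ∃ (ε : Fin N → ℚ) (r : Finset (Fin N → ℚ)),
        (∀ v ∈ r, 0 ≤ pair ω v) ∧ ε - γ ∈ r ∧ ε - δ ∈ r := by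
      have h00 : pair ω (0 : Fin N → ℚ) = 0 := by
        rw [← sub_self (0 : Fin N → ℚ), pair_sub, sub_self]
      rcases le_total (pair ω γ) (pair ω δ) with h | h
      · refine ⟨δ, {δ - γ, 0}, ?_, by simp, by simp⟩
        simp [pair_sub, h, h00]
      · refine ⟨γ, {γ - δ, 0}, ?_, by simp, by simp⟩
        simp [pair_sub, h, h00]
    refine ⟨ε, ratCone (s ∪ t ∪ r), ⟨_, rfl⟩, ?_, ?_⟩
    · rw [isPositiveCone_ratCone]
      intro v hv
      simp only [Finset.mem_union] at hv
      rcases hv with (hv | hv) | hv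
      exacts [hs v hv, ht v hv, hr v hv]
    · rintro α (hα | hα)
      · have : ε + α = (ε - γ) + (γ + α) := by abel
        rw [this, toReal_add]
        exact ratCone_add_mem (mem_ratCone (by simp [h1]))
          (ratCone_mono (by intro v; simp +contextual) (hsE α hα))
      · have : ε + α = (ε - δ) + (δ + α) := by abel
        rw [this, toReal_add]
        exact ratCone_add_mem (mem_ratCone (by simp [h2]))
          (ratCone_mono (by intro v; simp +contextual) (htF α hα))

theorem IsPositiveExponentSet.add {N : ℕ} {ω : Fin N → ℝ} {E F : Set (Fin N → ℚ)}
    (hE : IsPositiveExponentSet ω E) (hF : IsPositiveExponentSet ω F) :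
    IsPositiveExponentSet ω {α | ∃ β ∈ E, ∃ δ ∈ F, α = β + δ} := by
  classical
  obtain ⟨⟨k, hk, hkE⟩, γ, _, ⟨s, rfl⟩, hs, hsE⟩ := hE
  obtain ⟨⟨l, hl, hlF⟩, δ, _, ⟨t, rfl⟩, ht, htF⟩ := hF
  refine ⟨⟨k * l, Nat.mul_pos hk hl, ?_⟩, γ + δ, ratCone (s ∪ t), ⟨_, rfl⟩, ?_, ?_⟩
  · rintro _ ⟨α, hα, β, hβ, rfl⟩ i
    obtain ⟨m, hm⟩ := lattice_mul hl (hkE α hα) i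
    obtain ⟨n, hn⟩ := lattice_mul hk (hlF β hβ) i
    refine ⟨m + n, ?_⟩
    rw [mul_comm] at hn
    rw [Pi.add_apply, hm, hn]
    push_cast
    rw [add_div]
  · rw [isPositiveCone_ratCone] at hs ht ⊢
    intro v hv
    rcases Finset.mem_union.1 hv with hv | hv
    exacts [hs v hv, ht v hv]
  · rintro _ ⟨α, hα, β, hβ, rfl⟩
    have : γ + δ + (α + β) = (γ + α) + (δ + β) := by abel
    rw [this, toReal_add]
    exact ratCone_add_mem (ratCone_mono Finset.subset_union_left (hsE α hα))
      (ratCone_mono Finset.subset_union_right (htF β hβ))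

theorem isPositiveExponentSet_singleton {N : ℕ} (ω : Fin N → ℝ) (α : Fin N → ℤ) :
    IsPositiveExponentSet ω {fun i => (α i : ℚ)} := by
  refine ⟨⟨1, le_rfl, ?_⟩, -(fun i => (α i : ℚ)), ratCone ∅, ⟨_, rfl⟩, ?_, ?_⟩
  · rintro _ rfl i
    exact ⟨α i, by simp⟩
  · rw [isPositiveCone_ratCone]
    simp
  · rintro _ rfl
    refine ⟨0, fun _ => le_rfl, ?_⟩
    funext i
    simp [toReal]

/-- Every set of exponents of an `ω`-positive Puiseux series is well-ordered by `ω`; hence looking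
for `ω`-positive Puiseux series among Hahn series excludes none of them. -/
theorem IsPositiveExponentSet.isPWO {N : ℕ} {ω : Fin N → ℝ} (hω : LinearIndependent ℚ ω)
    {E : Set (Fin N → ℚ)} (hE : IsPositiveExponentSet ω E) :
    (toExp hω '' E).IsPWO := by
  classical
  obtain ⟨⟨k, hk, hkE⟩, γ, _, ⟨s, rfl⟩, hs, hsE⟩ := hE
  rw [isPositiveCone_ratCone] at hs
  have hk0 : (0 : ℝ) < k := by exact_mod_cast hk
  have hpos : ∀ v ∈ s, v ≠ 0 → 0 < pair ω v := fun v hv h0 =>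
    lt_of_le_of_ne (hs v hv) fun h => h0 (pair_injective hω (by
      rw [← h]; simp [pair, toReal, dotProduct]))
  have hfin : ∀ C : ℝ, {α ∈ E | pair ω α ≤ C}.Finite := by
    intro C
    set D : ℝ := pair ω γ + C
    let B : Fin N → ℝ := fun i => (∑ v ∈ s, D / pair ω v * |(v i : ℝ)|) + |(γ i : ℝ)|
    let b : Fin N → ℤ := fun i => ⌈k * B i⌉
    have hF : (Set.pi Set.univ fun i => (fun n : ℤ => (n : ℚ) / k) ''
        (Set.Icc (-b i) (b i))).Finite :=
      Set.Finite.pi fun i => (Set.finite_Icc _ _).image _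
    refine hF.subset ?_
    rintro α ⟨hα, hαC⟩ i -
    obtain ⟨c, hc, hcα⟩ := hsE α hα
    obtain ⟨n, hn⟩ := hkE α hα i
    refine ⟨n, ?_, hn.symm⟩
    have hsum : ∑ v ∈ s, c v * pair ω v = pair ω (γ + α) := by
      rw [pair, hcα, dotProduct_sum]
      exact Finset.sum_congr rfl fun v _ => by rw [dotProduct_smul, smul_eq_mul, pair]
    have hD : ∑ v ∈ s, c v * pair ω v ≤ D := by
      rw [hsum, pair_add]
      simp only [D]
      linarith
    have hle : ∀ v ∈ s, c v * pair ω v ≤ D := fun v hv =>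
      (Finset.single_le_sum (f := fun v => c v * pair ω v)
        (fun w hw => mul_nonneg (hc w) (hs w hw)) hv).trans hD
    have hi : (γ i : ℝ) + α i = ∑ v ∈ s, c v * (v i : ℝ) := by
      have := congrFun hcα i
      simpa [toReal] using this
    have h1 : |(γ i : ℝ) + α i| ≤ ∑ v ∈ s, D / pair ω v * |(v i : ℝ)| := by
      rw [hi]
      refine (Finset.abs_sum_le_sum_abs _ _).trans (Finset.sum_le_sum fun v hv => ?_)
      rw [abs_mul, abs_of_nonneg (hc v)]
      by_cases h0 : v = 0
      · simp [h0]
      · exact mul_le_mul_of_nonneg_right ((le_div_iff₀ (hpos v hv h0)).2 (hle v hv)) (abs_nonneg _)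
    have h2 : |(α i : ℝ)| ≤ B i := by
      have h3 : (α i : ℝ) = ((γ i : ℝ) + α i) - γ i := by ring
      rw [h3]
      exact (abs_sub _ _).trans (by simp only [B]; linarith)
    have hn' : (n : ℝ) = k * (α i : ℝ) := by
      rw [hn]
      push_cast
      field_simp
    have h4 : |(n : ℝ)| ≤ b i := by
      rw [hn', abs_mul, abs_of_pos hk0]
      exact (mul_le_mul_of_nonneg_left h2 hk0.le).trans (Int.le_ceil _)
    have h5 : |n| ≤ b i := by exact_mod_cast h4
    exact abs_le.1 h5
  refine Set.IsWF.isPWO (Set.isWF_iff_no_descending_seq.2 ?_)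
  intro f hf hfE
  have hanti : ∀ n, pair ω ((toExp hω).symm (f n)) ≤ pair ω ((toExp hω).symm (f 0)) :=
    fun n => hf.antitone (Nat.zero_le n)
  have hmem : ∀ n, (toExp hω).symm (f n) ∈ E := fun n => by
    obtain ⟨α, hα, h⟩ := hfE n
    rw [← h]
    simpa using hα
  have hmem' : ∀ n, (toExp hω).symm (f n) ∈
      {α ∈ E | pair ω α ≤ pair ω ((toExp hω).symm (f 0))} := fun n => ⟨hmem n, hanti n⟩
  exact Set.infinite_of_injective_forall_mem
    ((toExp hω).symm.injective.comp hf.injective) hmem' (hfin _)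

/-! ### The field of `ω`-positive Puiseux series -/

/-- The set of exponents `{α ∈ ℚ^N | c_α ≠ 0}` of a series `∑ c_α x^α`. -/
def exponents {K : Type*} [Field K] {N : ℕ} {ω : Fin N → ℝ} {hω : LinearIndependent ℚ ω}
    (φ : HahnSeries (Exponent ω hω) K) : Set (Fin N → ℚ) :=
  {α | φ.coeff (toExp hω α) ≠ 0}

/-- The field `S_ω` of `ω`-positive Puiseux series with coefficients in `K`: formal series
`∑ c_α x^α`, `α ∈ ℚ^N`, whose set of exponents is that of an `ω`-positive Puiseux series. Sums and
products are those of formal series. -/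
def PuiseuxField (K : Type*) [Field K] {N : ℕ} (ω : Fin N → ℝ) (hω : LinearIndependent ℚ ω) :
    Subalgebra K (HahnSeries (Exponent ω hω) K) where
  carrier := {φ | IsPositiveExponentSet ω (exponents φ)}
  mul_mem' {φ ψ} hφ hψ := by
    refine (IsPositiveExponentSet.add hφ hψ).mono fun α hα => ?_
    obtain ⟨β, hβ, δ, hδ, h⟩ := HahnSeries.support_mul_subset ((HahnSeries.mem_support _ _).2 hα)
    refine ⟨(toExp hω).symm β, by simpa [exponents] using hβ, (toExp hω).symm δ,
      by simpa [exponents] using hδ, (toExp hω).injective ?_⟩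
    rw [← map_add]
    simpa using h.symm
  add_mem' {φ ψ} hφ hψ := by
    refine (IsPositiveExponentSet.union hφ hψ).mono fun α hα => ?_
    exact HahnSeries.support_add_subset φ ψ ((HahnSeries.mem_support _ _).2 hα)
  algebraMap_mem' c := by
    refine (isPositiveExponentSet_singleton ω 0).mono fun α hα => ?_
    have h : toExp hω α = 0 := by
      by_contra h
      exact hα (by simp [HahnSeries.algebraMap_apply, HahnSeries.coeff_single_of_ne h])
    have h' : α = 0 := by simpa using h
    rw [h']
    simp only [Set.mem_singleton_iff]
    funext i
    simp

/-- The monomial `x^α`, `α ∈ ℤ^N`, in `S_ω`. -/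
def xMonomial (K : Type*) [Field K] {N : ℕ} (ω : Fin N → ℝ) (hω : LinearIndependent ℚ ω)
    (α : Fin N → ℤ) : PuiseuxField K ω hω :=
  ⟨HahnSeries.single (toExp hω fun i => (α i : ℚ)) 1, by
    refine (isPositiveExponentSet_singleton ω α).mono fun β hβ => ?_
    by_contra h
    exact hβ (HahnSeries.coeff_single_of_ne fun h' => h ((toExp hω).injective h'))⟩

/-! ### The ring `K[x^{±1}, y]` and extension of ideals to `S_ω[y]` -/

/-- `K[x_1^{±1}, …, x_N^{±1}]`. -/
abbrev Laurent (K : Type*) [Field K] (N : ℕ) : Type _ := AddMonoidAlgebra K (Fin N → ℤ)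

/-- `K[x_1^{±1}, …, x_N^{±1}][y_1, …, y_M]`. -/
abbrev LaurentPoly (K : Type*) [Field K] (N M : ℕ) : Type _ := MvPolynomial (Fin M) (Laurent K N)

/-- The term `a x^α y^β`. -/
def term {K : Type*} [Field K] {N M : ℕ} (a : K) (α : Fin N → ℤ) (β : Fin M →₀ ℕ) :
    LaurentPoly K N M :=
  MvPolynomial.monomial β (AddMonoidAlgebra.single α a)

/-- The natural inclusion of `K[x^{±1}]` in `S_ω`. -/
def laurentToPuiseux (K : Type*) [Field K] {N : ℕ} (ω : Fin N → ℝ) (hω : LinearIndependent ℚ ω) :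
    Laurent K N →ₐ[K] PuiseuxField K ω hω :=
  AddMonoidAlgebra.lift K (PuiseuxField K ω hω) (Fin N → ℤ)
    { toFun := fun α => xMonomial K ω hω α.toAdd
      map_one' := by
        apply Subtype.ext
        change HahnSeries.single (toExp hω fun i => (((0 : Fin N → ℤ) i : ℤ) : ℚ)) (1 : K) =
          HahnSeries.single (0 : Exponent ω hω) (1 : K)
        have h : (fun i => (((0 : Fin N → ℤ) i : ℤ) : ℚ)) = 0 := by funext i; simp
        rw [h, map_zero]
      map_mul' := fun α β => by
        apply Subtype.ext
        change HahnSeries.single (toExp hω fun i => ((α.toAdd i + β.toAdd i : ℤ) : ℚ)) (1 : K) =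
          HahnSeries.single (toExp hω fun i => (α.toAdd i : ℚ)) (1 : K) *
            HahnSeries.single (toExp hω fun i => (β.toAdd i : ℚ)) (1 : K)
        rw [HahnSeries.single_mul_single, mul_one, ← map_add]
        have h : (fun i => ((α.toAdd i + β.toAdd i : ℤ) : ℚ)) =
            (fun i => (α.toAdd i : ℚ)) + fun i => (β.toAdd i : ℚ) := by
          funext i; simp
        rw [h] }

/-- The extension of an ideal of `K[x^{±1}, y]` to `S_ω[y]`. -/
def extension {K : Type*} [Field K] {N M : ℕ} {ω : Fin N → ℝ} (hω : LinearIndependent ℚ ω)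
    (I : Ideal (LaurentPoly K N M)) : Ideal (MvPolynomial (Fin M) (PuiseuxField K ω hω)) :=
  I.map (MvPolynomial.map (laurentToPuiseux K ω hω : Laurent K N →+* PuiseuxField K ω hω))

/-- `φ ∈ S_ω^M` is an `ω`-solution of `I` when it is a common zero of the extension of `I` to
`S_ω[y]`. -/
def IsOmegaSolution {K : Type*} [Field K] {N M : ℕ} {ω : Fin N → ℝ}
    (hω : LinearIndependent ℚ ω) (I : Ideal (LaurentPoly K N M))
    (φ : Fin M → PuiseuxField K ω hω) : Prop :=
  ∀ f ∈ extension hω I, MvPolynomial.eval φ f = 0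

/-! ### Weighted orders, initial ideals, tropical variety -/

/-- The set `Λ(η)` of indices `i` with `η_i ≠ ∞`. -/
def finiteIndices {M : ℕ} (η : Fin M → WithTop ℝ) : Set (Fin M) := {i | η i ≠ ⊤}

/-- The weight `ω · α + η · β ∈ ℝ ∪ {∞}` of the term `x^α y^β`, with `∞ · 0 = 0` and `∞ · b = ∞`
for `b > 0`. -/
def weight {N M : ℕ} (ω : Fin N → ℝ) (η : Fin M → WithTop ℝ) (α : Fin N → ℤ)
    (β : Fin M →₀ ℕ) : WithTop ℝ :=
  ((∑ i, ω i * (α i : ℝ) : ℝ) : WithTop ℝ) + ∑ j, β j • η j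

/-- The `(ω, η)`-order: the least weight of a term occurring in `f` (`∞` if `f = 0`). -/
def weightedOrder {K : Type*} [Field K] {N M : ℕ} (ω : Fin N → ℝ) (η : Fin M → WithTop ℝ)
    (f : LaurentPoly K N M) : WithTop ℝ :=
  f.support.inf fun β => (f.coeff β).coeff.support.inf fun α => weight ω η α β

open Classical in
/-- The `(ω, η)`-initial part: the sum of the terms of `f` of least weight if the order of `f` is
finite, and `0` otherwise. -/
def initialPart {K : Type*} [Field K] {N M : ℕ} (ω : Fin N → ℝ) (η : Fin M → WithTop ℝ)
    (f : LaurentPoly K N M) : LaurentPoly K N M :=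
  if weightedOrder ω η f = ⊤ then 0 else
    ∑ β ∈ f.support, ∑ α ∈ (f.coeff β).coeff.support with weight ω η α β = weightedOrder ω η f,
      term ((f.coeff β).coeff α) α β

/-- The `(ω, η)`-initial ideal: it is generated by the initial parts of the elements of `I` and
the variables `y_i` with `η_i = ∞`. -/
def initialIdeal {K : Type*} [Field K] {N M : ℕ} (ω : Fin N → ℝ) (η : Fin M → WithTop ℝ)
    (I : Ideal (LaurentPoly K N M)) : Ideal (LaurentPoly K N M) :=
  Ideal.span ({g | ∃ f ∈ I, g = initialPart ω η f} ∪
    {g | ∃ i ∉ finiteIndices η, g = MvPolynomial.X i})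

/-- A monomial of `K[x^{±1}, y]` is a term `c x^α y^β` with `c ∈ K`, `c ≠ 0`. -/
def IsMonomial {K : Type*} [Field K] {N M : ℕ} (g : LaurentPoly K N M) : Prop :=
  ∃ (c : K) (α : Fin N → ℤ) (β : Fin M →₀ ℕ), c ≠ 0 ∧ g = term c α β

/-- The tropical variety of `I`: the pairs `(ω, η) ∈ ℝ^N × (ℝ ∪ {∞})^M` for which the
intersection of the `(ω, η)`-initial ideal of `I` with `K[x^{±1}, y_{Λ(η)}]` contains no
monomial. -/
def tropicalVariety {K : Type*} [Field K] {N M : ℕ} (I : Ideal (LaurentPoly K N M)) :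
    Set ((Fin N → ℝ) × (Fin M → WithTop ℝ)) :=
  {p | ∀ g ∈ initialIdeal p.1 p.2 I,
    g ∈ MvPolynomial.supported (Laurent K N) (finiteIndices p.2) → ¬ IsMonomial g}

/-- The torus `T_η ⊆ S_ω^M` of the `M`-tuples `φ` with `φ_i ≠ 0` for `i ∈ Λ(η)` and `φ_i = 0` for
`i ∉ Λ(η)`. -/
def torus (K : Type*) [Field K] {N M : ℕ} {ω : Fin N → ℝ} (hω : LinearIndependent ℚ ω)
    (η : Fin M → WithTop ℝ) : Set (Fin M → PuiseuxField K ω hω) :=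
  {φ | (∀ i ∈ finiteIndices η, φ i ≠ 0) ∧ ∀ i ∉ finiteIndices η, φ i = 0}

end OmegaPuiseux

end

noncomputable section

namespace OmegaPuiseux

/-! ### Points of finitely generated algebras -/

/-- Over an algebraically closed field, an element of a finitely generated algebra no power of
which lies in the ideal `J` takes a nonzero value at some point of the zero set of `J`. -/
theorem exists_algHom_of_notMem_radical {K R : Type*} [Field K] [IsAlgClosed K] [CommRing R]
    [Algebra K R] [Algebra.FiniteType K R] (J : Ideal R) {p : R} (hp : p ∉ J.radical) :
    ∃ ψ : R →ₐ[K] K, (∀ f ∈ J, ψ f = 0) ∧ ψ p ≠ 0 := by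
  have : IsJacobsonRing R := isJacobsonRing_of_finiteType (A := K)
  rw [Ideal.radical_eq_jacobson, Ideal.jacobson, Submodule.mem_sInf] at hp
  push Not at hp
  obtain ⟨m, ⟨hJm, hm⟩, hpm⟩ := hp
  let _ : Field (R ⧸ m) := Ideal.Quotient.field m
  have : Algebra.FiniteType K (R ⧸ m) :=
    Algebra.FiniteType.of_surjective (Ideal.Quotient.mkₐ K m) (Ideal.Quotient.mkₐ_surjective K m)
  have : Module.Finite K (R ⧸ m) := finite_of_finite_type_of_isJacobsonRing K (R ⧸ m)
  let e : K ≃ₐ[K] (R ⧸ m) := AlgEquiv.ofBijective (Algebra.ofId K (R ⧸ m))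
    IsAlgClosed.algebraMap_bijective_of_isIntegral
  refine ⟨(e.symm : (R ⧸ m) →ₐ[K] K).comp (Ideal.Quotient.mkₐ K m), fun f hf => ?_, ?_⟩
  · simpa using Ideal.Quotient.eq_zero_iff_mem.2 (hJm hf)
  · simpa using mt Ideal.Quotient.eq_zero_iff_mem.1 hpm

/-- A character `ℤ^N → K^*` extends to `ℚ^N` when `K` is algebraically closed. -/
theorem exists_rat_character {K : Type*} [Field K] [IsAlgClosed K] {N : ℕ}
    (χ : (Fin N → ℤ) →+ Additive Kˣ) :
    ∃ χ' : (Fin N → ℚ) →+ Additive Kˣ, ∀ α : Fin N → ℤ, χ' (fun i => (α i : ℚ)) = χ α := by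
  have hroot : ∀ n : ℤ, n ≠ 0 → Function.Surjective fun u : Additive Kˣ => n • u := by
    intro n hn u
    have hnat : ∃ v : Kˣ, v ^ n.natAbs = u.toMul := by
      obtain ⟨z, hz⟩ := IsAlgClosed.exists_pow_nat_eq (u.toMul : K) (Int.natAbs_pos.2 hn)
      have hz0 : z ≠ 0 := by
        rintro rfl
        rw [zero_pow (Int.natAbs_ne_zero.2 hn)] at hz
        exact u.toMul.ne_zero hz.symm
      exact ⟨Units.mk0 z hz0, Units.ext (by simpa using hz)⟩
    obtain ⟨v, hv⟩ := hnat
    have hv' : n.natAbs • Additive.ofMul v = u := by rw [← ofMul_pow, hv, ofMul_toMul]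
    rcases Int.natAbs_eq n with h | h
    · refine ⟨Additive.ofMul v, ?_⟩
      dsimp only
      rw [h, natCast_zsmul, hv']
    · refine ⟨-Additive.ofMul v, ?_⟩
      dsimp only
      rw [h, neg_smul, smul_neg, neg_neg, natCast_zsmul, hv']
  let _ : DivisibleBy (Additive Kˣ) ℤ := divisibleByOfSMulRightSurj _ _ (fun h => hroot _ h)
  let ι : (Fin N → ℤ) →+ (Fin N → ℚ) :=
    { toFun := fun α i => (α i : ℚ)
      map_zero' := by funext i; simp
      map_add' := fun α β => by funext i; simp }
  have hι : Function.Injective ι := fun α β h => by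
    funext i
    exact Int.cast_injective (α := ℚ) (congrFun h i)
  obtain ⟨χ', h⟩ := (Module.Baer.of_divisible (Additive Kˣ)).extension_property_addMonoidHom ι hι χ
  exact ⟨χ', fun α => DFunLike.congr_fun h α⟩

/-- There is a `ℚ`-linear map `ℝ → ℚ^N` that recovers `α` from `ω · α`. -/
theorem exists_pair_retraction {N : ℕ} {ω : Fin N → ℝ} (hω : LinearIndependent ℚ ω) :
    ∃ p : ℝ →ₗ[ℚ] (Fin N → ℚ), ∀ α : Fin N → ℚ, p (pair ω α) = α := by
  obtain ⟨p, hp⟩ := (Fintype.linearCombination ℚ ω).exists_leftInverse_of_injective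
    (LinearMap.ker_eq_bot.2 (linearIndependent_iff_injective_fintypeLinearCombination.1 hω))
  refine ⟨p, fun α => ?_⟩
  have h : pair ω α = Fintype.linearCombination ℚ ω α := by
    simp only [pair, dotProduct, toReal, Fintype.linearCombination_apply, Rat.smul_def]
    exact Finset.sum_congr rfl fun i _ => mul_comm _ _
  rw [h]
  exact DFunLike.congr_fun hp α

/-! ### Single terms in `S_ω` -/

theorem isPositiveExponentSet_singleton_rat {N : ℕ} (ω : Fin N → ℝ) (α : Fin N → ℚ) :
    IsPositiveExponentSet ω {α} := by
  refine ⟨⟨∏ i, (α i).den, Finset.prod_pos fun i _ => (α i).den_pos, ?_⟩, -α, ratCone ∅,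
    ⟨_, rfl⟩, ?_, ?_⟩
  · intro β hβ i
    rw [Set.mem_singleton_iff.1 hβ]
    obtain ⟨m, hm⟩ := Finset.dvd_prod_of_mem (fun i => (α i).den) (Finset.mem_univ i)
    have h0 : (∏ i, (α i).den) ≠ 0 := Finset.prod_ne_zero_iff.2 fun i _ => (α i).den_nz
    refine ⟨(α i).num * m, ?_⟩
    rw [hm] at h0 ⊢
    have hm0 : (m : ℚ) ≠ 0 := by exact_mod_cast right_ne_zero_of_mul h0
    push_cast
    rw [mul_div_mul_right _ _ hm0, Rat.num_div_den]
  · rw [isPositiveCone_ratCone]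
    simp
  · rintro _ rfl
    refine ⟨0, fun _ => le_rfl, ?_⟩
    funext i
    simp [toReal]

/-- The term `c x^γ`, `γ ∈ ℚ^N`, of `S_ω`. -/
def puiseuxTerm {K : Type*} [Field K] {N : ℕ} {ω : Fin N → ℝ} (hω : LinearIndependent ℚ ω)
    (γ : Fin N → ℚ) (c : K) : PuiseuxField K ω hω :=
  ⟨HahnSeries.single (toExp hω γ) c, (isPositiveExponentSet_singleton_rat ω γ).mono fun β hβ => by
    by_contra h
    exact hβ (HahnSeries.coeff_single_of_ne fun h' => h ((toExp hω).injective h'))⟩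

section puiseuxTerm

variable {K : Type*} [Field K] {N : ℕ} {ω : Fin N → ℝ} {hω : LinearIndependent ℚ ω}

theorem puiseuxTerm_mul (γ δ : Fin N → ℚ) (c d : K) :
    puiseuxTerm hω γ c * puiseuxTerm hω δ d = puiseuxTerm hω (γ + δ) (c * d) := by
  apply Subtype.ext
  simp [puiseuxTerm, HahnSeries.single_mul_single]

theorem puiseuxTerm_one : puiseuxTerm hω 0 (1 : K) = 1 := by
  apply Subtype.ext
  simp [puiseuxTerm]

theorem puiseuxTerm_sum {ι : Type*} (s : Finset ι) (γ : Fin N → ℚ) (c : ι → K) :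
    ∑ i ∈ s, puiseuxTerm hω γ (c i) = puiseuxTerm hω γ (∑ i ∈ s, c i) := by
  apply Subtype.ext
  rw [AddSubmonoidClass.coe_finsetSum]
  exact (map_sum (HahnSeries.single.addMonoidHom (toExp hω γ)) c s).symm

theorem puiseuxTerm_zero (γ : Fin N → ℚ) : puiseuxTerm hω γ (0 : K) = 0 := by
  apply Subtype.ext
  simp [puiseuxTerm]

theorem puiseuxTerm_ne_zero {γ : Fin N → ℚ} {c : K} (hc : c ≠ 0) : puiseuxTerm hω γ c ≠ 0 :=
  fun h => hc (HahnSeries.single_eq_zero_iff.1 (congrArg Subtype.val h))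

theorem puiseuxTerm_pow (γ : Fin N → ℚ) (c : K) (n : ℕ) :
    puiseuxTerm hω γ c ^ n = puiseuxTerm hω (n • γ) (c ^ n) := by
  induction n with
  | zero => simp [puiseuxTerm_one]
  | succ n ih => rw [pow_succ, ih, puiseuxTerm_mul, succ_nsmul, pow_succ]

theorem puiseuxTerm_prod {ι : Type*} (s : Finset ι) (γ : ι → Fin N → ℚ) (c : ι → K) :
    ∏ i ∈ s, puiseuxTerm hω (γ i) (c i) = puiseuxTerm hω (∑ i ∈ s, γ i) (∏ i ∈ s, c i) := by
  classical
  induction s using Finset.induction_on with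
  | empty => simp [puiseuxTerm_one]
  | insert i s hi ih =>
    rw [Finset.prod_insert hi, ih, puiseuxTerm_mul, Finset.sum_insert hi, Finset.prod_insert hi]

theorem laurentToPuiseux_single (α : Fin N → ℤ) (a : K) :
    laurentToPuiseux K ω hω (AddMonoidAlgebra.single α a) =
      puiseuxTerm hω (fun i => (α i : ℚ)) a := by
  apply Subtype.ext
  rw [laurentToPuiseux, AddMonoidAlgebra.lift_single]
  change a • HahnSeries.single (toExp hω fun i => (α i : ℚ)) (1 : K) = _
  ext β
  simp [puiseuxTerm, HahnSeries.coeff_single]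

end puiseuxTerm

/-! ### Evaluation of polynomials at points of `S_ω^M` -/

section evaluation

variable {K : Type*} [Field K] {N M : ℕ} {ω : Fin N → ℝ} {hω : LinearIndependent ℚ ω}

/-- Evaluation of the elements of `K[x^{±1}, y]` at a point of `S_ω^M`. -/
def evalPuiseux (φ : Fin M → PuiseuxField K ω hω) : LaurentPoly K N M →+* PuiseuxField K ω hω :=
  (MvPolynomial.eval φ).comp
    (MvPolynomial.map (laurentToPuiseux K ω hω : Laurent K N →+* PuiseuxField K ω hω))

theorem evalPuiseux_term (φ : Fin M → PuiseuxField K ω hω) (a : K) (α : Fin N → ℤ)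
    (β : Fin M →₀ ℕ) :
    evalPuiseux φ (term a α β) = puiseuxTerm hω (fun i => (α i : ℚ)) a * ∏ j, φ j ^ β j := by
  rw [evalPuiseux, term, RingHom.comp_apply, MvPolynomial.map_monomial, MvPolynomial.eval_monomial,
    Finsupp.prod_fintype _ _ fun _ => pow_zero _]
  congr 1
  exact laurentToPuiseux_single α a

theorem isOmegaSolution_iff (J : Ideal (LaurentPoly K N M)) (φ : Fin M → PuiseuxField K ω hω) :
    IsOmegaSolution hω J φ ↔ ∀ f ∈ J, evalPuiseux φ f = 0 := by
  refine ⟨fun h f hf => h _ (Ideal.mem_map_of_mem _ hf), fun h f hf => ?_⟩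
  have hle : extension hω J ≤ RingHom.ker (MvPolynomial.eval φ) :=
    Ideal.map_le_iff_le_comap.2 fun g hg => h g hg
  exact hle hf

theorem isOmegaSolution_initialIdeal_iff (η : Fin M → WithTop ℝ) (I : Ideal (LaurentPoly K N M))
    (φ : Fin M → PuiseuxField K ω hω) :
    IsOmegaSolution hω (initialIdeal ω η I) φ ↔
      (∀ f ∈ I, evalPuiseux φ (initialPart ω η f) = 0) ∧ ∀ i ∉ finiteIndices η, φ i = 0 := by
  have hX : ∀ i, evalPuiseux φ (MvPolynomial.X i) = φ i := fun i => by simp [evalPuiseux]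
  rw [isOmegaSolution_iff]
  constructor
  · intro h
    refine ⟨fun f hf => h _ (Ideal.subset_span (Or.inl ⟨f, hf, rfl⟩)), fun i hi => ?_⟩
    rw [← hX]
    exact h _ (Ideal.subset_span (Or.inr ⟨i, hi, rfl⟩))
  · rintro ⟨h1, h2⟩
    have hle : initialIdeal ω η I ≤ RingHom.ker (evalPuiseux φ) := by
      refine Ideal.span_le.2 ?_
      rintro g (⟨f, hf, rfl⟩ | ⟨i, hi, rfl⟩)
      exacts [h1 f hf, (hX i).trans (h2 i hi)]
    exact fun f hf => hle hf

end evaluation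

/-! ### Weights -/

/-- A term of finite weight involves only the variables `y_j` with `η_j ≠ ∞`. -/
theorem eq_zero_of_weight_ne_top {N M : ℕ} {ω : Fin N → ℝ} {η : Fin M → WithTop ℝ}
    {α : Fin N → ℤ} {β : Fin M →₀ ℕ} (h : weight ω η α β ≠ ⊤) {j : Fin M} (hj : η j = ⊤) :
    β j = 0 := by
  by_contra hβ
  have h1 : ∑ j, β j • η j = ⊤ := WithTop.sum_eq_top.2
    ⟨j, Finset.mem_univ j, by
      obtain ⟨n, hn⟩ := Nat.exists_eq_succ_of_ne_zero hβ
      rw [hj, hn, Nat.succ_eq_add_one, succ_nsmul, WithTop.add_top]⟩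
  exact h (by rw [weight, h1, WithTop.add_top])

/-- A retraction of `α ↦ ω · α` recovers the exponent `α + ∑ β_j γ_j`, where `γ_j` is the image of
`η_j`, from the weight of `x^α y^β`. -/
theorem retraction_weight {N M : ℕ} {ω : Fin N → ℝ} (η : Fin M → WithTop ℝ)
    {p : ℝ →ₗ[ℚ] (Fin N → ℚ)} (hp : ∀ α : Fin N → ℚ, p (pair ω α) = α) {α : Fin N → ℤ}
    {β : Fin M →₀ ℕ} (h : weight ω η α β ≠ ⊤) :
    (fun i => (α i : ℚ)) + ∑ j, β j • p ((η j).untopD 0) = p ((weight ω η α β).untopD 0) := by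
  have h1 : weight ω η α β =
      ((pair ω (fun i => (α i : ℚ)) + ∑ j, β j • (η j).untopD 0 : ℝ) : WithTop ℝ) := by
    rw [WithTop.coe_add, WithTop.coe_sum, weight]
    refine congrArg₂ _ ?_ ?_
    · simp [pair, dotProduct, toReal]
    · refine Finset.sum_congr rfl fun j _ => ?_
      cases hj : η j with
      | top => simp [eq_zero_of_weight_ne_top h hj]
      | coe r => rw [WithTop.untopD_coe, WithTop.coe_nsmul]
  rw [h1, WithTop.untopD_coe, map_add, hp, map_sum]
  simp_rw [map_nsmul]

/-! ### Monomials -/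

section monomials

variable {K : Type*} [Field K] {N M : ℕ}

theorem term_mul (a b : K) (α α' : Fin N → ℤ) (β β' : Fin M →₀ ℕ) :
    (term a α β * term b α' β' : LaurentPoly K N M) = term (a * b) (α + α') (β + β') := by
  rw [term, term, MvPolynomial.monomial_mul, AddMonoidAlgebra.single_mul_single, term]

theorem term_one : (term 1 0 0 : LaurentPoly K N M) = 1 := rfl

theorem term_eq (a : K) (α : Fin N → ℤ) (β : Fin M →₀ ℕ) :
    (term a α β : LaurentPoly K N M) =
      algebraMap K _ a * term 1 α 0 * ∏ j, MvPolynomial.X j ^ β j := by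
  have h : (∏ j, MvPolynomial.X j ^ β j : LaurentPoly K N M) = term 1 0 β := by
    rw [← Finsupp.prod_fintype β _ fun _ => pow_zero _]
    exact MvPolynomial.prod_X_pow_eq_monomial
  have ha : algebraMap K (LaurentPoly K N M) a = term a 0 0 := rfl
  rw [h, ha, term_mul, term_mul]
  simp

/-- The character `α ↦ x^α` of `ℤ^N` at a point of the spectrum of `K[x^{±1}, y]`. -/
def pointCharacter (ψ : LaurentPoly K N M →ₐ[K] K) : (Fin N → ℤ) →+ Additive Kˣ :=
  MonoidHom.toAdditiveRight
    (MonoidHom.toHomUnits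
      { toFun := fun α : Multiplicative (Fin N → ℤ) => ψ (term 1 α.toAdd 0)
        map_one' := by rw [toAdd_one, term_one, map_one]
        map_mul' := fun α α' => by rw [toAdd_mul, ← map_mul, term_mul, one_mul, add_zero] })

theorem pointCharacter_apply (ψ : LaurentPoly K N M →ₐ[K] K) (α : Fin N → ℤ) :
    ((pointCharacter ψ α).toMul : K) = ψ (term 1 α 0) := rfl

end monomials

/-! ### Points of the initial ideal -/

section points

variable {K : Type*} [Field K] {N M : ℕ} {ω : Fin N → ℝ} {hω : LinearIndependent ℚ ω}

/-- At a point of the torus of `η` no monomial in the variables `y_i`, `i ∈ Λ(η)`, vanishes. -/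
theorem evalPuiseux_ne_zero_of_isMonomial {η : Fin M → WithTop ℝ}
    {φ : Fin M → PuiseuxField K ω hω} (hφ : φ ∈ torus K hω η) {g : LaurentPoly K N M}
    (hg : g ∈ MvPolynomial.supported (Laurent K N) (finiteIndices η)) (hm : IsMonomial g) :
    evalPuiseux φ g ≠ 0 := by
  obtain ⟨c, α, β, hc, rfl⟩ := hm
  rw [evalPuiseux_term]
  refine mul_ne_zero (puiseuxTerm_ne_zero hc) (Finset.prod_ne_zero_iff.2 fun j _ => ?_)
  by_cases hj : β j = 0
  · rw [hj, pow_zero]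
    exact one_ne_zero
  · refine pow_ne_zero _ (hφ.1 j (MvPolynomial.mem_supported.1 hg ?_))
    rw [term, Finset.mem_coe, MvPolynomial.vars_monomial, Finsupp.mem_support_iff]
    · exact hj
    · exact fun h => hc (AddMonoidAlgebra.single_eq_zero.1 h)

/-- If the `(ω, η)`-initial ideal contains no monomial in the variables `y_i`, `i ∈ Λ(η)`, then
its zero set over `K` has a point with `y_i ≠ 0` for `i ∈ Λ(η)`. -/
theorem exists_point_of_mem_tropicalVariety [IsAlgClosed K] {I : Ideal (LaurentPoly K N M)}
    {η : Fin M → WithTop ℝ} (h : (ω, η) ∈ tropicalVariety I) :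
    ∃ ψ : LaurentPoly K N M →ₐ[K] K, (∀ f ∈ initialIdeal ω η I, ψ f = 0) ∧
      ∀ i ∈ finiteIndices η, ψ (MvPolynomial.X i) ≠ 0 := by
  classical
  have : Algebra.FiniteType K (LaurentPoly K N M) :=
    Algebra.FiniteType.trans (S := Laurent K N) inferInstance inferInstance
  let β : Fin M →₀ ℕ := Finsupp.equivFunOnFinite.symm fun i => if i ∈ finiteIndices η then 1 else 0
  have hβ : ∀ i, β i = if i ∈ finiteIndices η then 1 else 0 := fun i => rfl
  have hpow : ∀ n : ℕ, (term 1 0 β : LaurentPoly K N M) ^ n = term 1 0 (n • β) := fun n => by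
    rw [term, MvPolynomial.monomial_pow, AddMonoidAlgebra.single_pow, one_pow, smul_zero, term]
  have hrad : (term 1 0 β : LaurentPoly K N M) ∉ (initialIdeal ω η I).radical := by
    rintro ⟨n, hn⟩
    rw [hpow] at hn
    refine h _ hn ?_ ⟨1, 0, n • β, one_ne_zero, rfl⟩
    rw [MvPolynomial.mem_supported]
    intro i hi
    rw [term, Finset.mem_coe, MvPolynomial.vars_monomial
      (fun h => one_ne_zero (AddMonoidAlgebra.single_eq_zero.1 h)), Finsupp.mem_support_iff] at hi
    by_contra hi'
    exact hi (by rw [Finsupp.smul_apply, hβ, if_neg hi', smul_zero])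
  obtain ⟨ψ, hψ, hψβ⟩ := exists_algHom_of_notMem_radical (K := K) _ hrad
  refine ⟨ψ, hψ, fun i hi => ?_⟩
  rw [term_eq, map_mul, map_prod] at hψβ
  have := Finset.prod_ne_zero_iff.1 (right_ne_zero_of_mul hψβ) i (Finset.mem_univ i)
  rwa [hβ, if_pos hi, pow_one] at this

/-- A point `ψ` of the zero set over `K` yields a point of `S_ω^M`, of coordinates
`c_i x^{γ_i}` with `c_i` proportional to `ψ(y_i)`, at which the initial part of every `f` is
a multiple of its value at `ψ`. -/
theorem exists_puiseux_point [IsAlgClosed K] (hω : LinearIndependent ℚ ω) (η : Fin M → WithTop ℝ)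
    (ψ : LaurentPoly K N M →ₐ[K] K) :
    ∃ φ : Fin M → PuiseuxField K ω hω, (∀ i, φ i = 0 ↔ ψ (MvPolynomial.X i) = 0) ∧
      ∀ f, ψ (initialPart ω η f) = 0 → evalPuiseux φ (initialPart ω η f) = 0 := by
  obtain ⟨χ, hχ⟩ := exists_rat_character (pointCharacter ψ)
  obtain ⟨p, hp⟩ := exists_pair_retraction hω
  let γ : Fin M → Fin N → ℚ := fun j => p ((η j).untopD 0)
  let u : (Fin N → ℚ) → K := fun δ => ((χ (-δ)).toMul : Kˣ)
  have hu0 : ∀ δ, u δ ≠ 0 := fun δ => Units.ne_zero _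
  have hu_zero : u 0 = 1 := by simp [u]
  have hu_add : ∀ δ ε, u (δ + ε) = u δ * u ε := fun δ ε => by
    simp only [u, neg_add, map_add, toMul_add, Units.val_mul]
  have hu_nsmul : ∀ (n : ℕ) δ, u (n • δ) = u δ ^ n := fun n δ => by
    simp only [u, ← smul_neg, map_nsmul, toMul_nsmul, Units.val_pow_eq_pow_val]
  have hu_sum : ∀ v : Fin M → Fin N → ℚ, u (∑ j, v j) = ∏ j, u (v j) := fun v => by
    simp only [u, ← Finset.sum_neg_distrib, map_sum, toMul_sum, Units.coe_prod]
  have hu_int : ∀ α : Fin N → ℤ, ψ (term 1 α 0) * u (fun i => (α i : ℚ)) = 1 := fun α => by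
    rw [← pointCharacter_apply, ← hχ, ← Units.val_mul, ← toMul_add, ← map_add, add_neg_cancel,
      map_zero, toMul_zero, Units.val_one]
  refine ⟨fun j => puiseuxTerm hω (γ j) (ψ (MvPolynomial.X j) * u (γ j)), fun i => ?_, ?_⟩
  · constructor
    · intro h
      by_contra h0
      exact puiseuxTerm_ne_zero (mul_ne_zero h0 (hu0 _)) h
    · intro h
      dsimp only
      rw [h, zero_mul, puiseuxTerm_zero]
  intro f hf
  have hterm : ∀ (a : K) (α : Fin N → ℤ) (β : Fin M →₀ ℕ), weight ω η α β ≠ ⊤ →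
      evalPuiseux (fun j => puiseuxTerm hω (γ j) (ψ (MvPolynomial.X j) * u (γ j))) (term a α β) =
        puiseuxTerm hω (p ((weight ω η α β).untopD 0))
          (ψ (term a α β) * u (p ((weight ω η α β).untopD 0))) := by
    intro a α β h
    simp only [evalPuiseux_term, puiseuxTerm_pow, puiseuxTerm_prod, puiseuxTerm_mul]
    rw [← retraction_weight η hp h, term_eq, hu_add, hu_sum]
    simp only [map_mul, map_prod, map_pow, hu_nsmul, mul_pow, Finset.prod_mul_distrib, γ,
      AlgHom.commutes, Algebra.algebraMap_self, RingHom.id_apply]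
    congr 1
    linear_combination (-a * (∏ j, ψ (MvPolynomial.X j) ^ β j) *
      ∏ j, u (p ((η j).untopD 0)) ^ β j) * hu_int α
  unfold initialPart at hf ⊢
  split_ifs at hf ⊢ with htop
  · exact map_zero _
  · set δ := p ((weightedOrder ω η f).untopD 0)
    have hsum : ∀ β : Fin M →₀ ℕ, ∀ α ∈ {α ∈ (f.coeff β).coeff.support |
        weight ω η α β = weightedOrder ω η f},
        evalPuiseux (fun j => puiseuxTerm hω (γ j) (ψ (MvPolynomial.X j) * u (γ j)))
          (term ((f.coeff β).coeff α) α β) =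
        puiseuxTerm hω δ (ψ (term ((f.coeff β).coeff α) α β) * u δ) := by
      intro β α hα
      have hw := (Finset.mem_filter.1 hα).2
      rw [hterm _ _ _ (hw ▸ htop), hw]
    simp only [map_sum] at hf ⊢
    rw [Finset.sum_congr rfl fun β _ => Finset.sum_congr rfl (hsum β)]
    simp only [puiseuxTerm_sum, ← Finset.sum_mul]
    rw [hf, zero_mul, puiseuxTerm_zero]

end points

end OmegaPuiseux

end

theorem mainTheorem5 {K : Type*} [Field K] [IsAlgClosed K] [CharZero K] {N M : ℕ}
    (ω : Fin N → ℝ) (hω : LinearIndependent ℚ ω)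
    (I : Ideal (OmegaPuiseux.LaurentPoly K N M)) (η : Fin M → WithTop ℝ) :
    (∃ φ ∈ OmegaPuiseux.torus K hω η,
      OmegaPuiseux.IsOmegaSolution hω (OmegaPuiseux.initialIdeal ω η I) φ) ↔
    (ω, η) ∈ OmegaPuiseux.tropicalVariety I := by
  open OmegaPuiseux in
  constructor
  · rintro ⟨φ, hφ, hsol⟩ g hg hsupp hm
    exact evalPuiseux_ne_zero_of_isMonomial hφ hsupp hm ((isOmegaSolution_iff _ φ).1 hsol g hg)
  · intro h
    obtain ⟨ψ, hψ, hψ0⟩ := exists_point_of_mem_tropicalVariety h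
    obtain ⟨φ, hφ, hφI⟩ := exists_puiseux_point hω η ψ
    have hφ0 : ∀ i ∉ finiteIndices η, φ i = 0 := fun i hi =>
      (hφ i).2 (hψ _ (Ideal.subset_span (Or.inr ⟨i, hi, rfl⟩)))
    exact ⟨φ, ⟨fun i hi => mt (hφ i).1 (hψ0 i hi), hφ0⟩,
      (isOmegaSolution_initialIdeal_iff η I φ).2
        ⟨fun f hf => hφI f (hψ _ (Ideal.subset_span (Or.inl ⟨f, hf, rfl⟩))), hφ0⟩⟩
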